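/- Let $\mathbb{H}$ be the field of quaternions, and for integers $m\ge 1$ and $1\le p<\infty$ let $\ell_{p;\mathbb{H}}^m$ be the right $\mathbb{H}$-linear space $\mathbb{H}^m$ with the norm $\|x\|_p=\bigl(\sum_{i=1}^m|\xi_i|^p\bigr)^{1/p}$, $x=(\xi_i)_{i=1}^m$. For an even integer $p\ge 4$ let $N_{\mathbb{H}}(m,p)$ be the minimal $n$ for which there is an isometric embedding $\ell_{2;\mathbb{H}}^m\to\ell_{p;\mathbb{H}}^n$, i.e. a right $\mathbb{H}$-linear norm-preserving map; such an $n$ exists for all $m\ge 1$ and all even $p\ge 4$. Then for all integers $m\ge 2$ and $s\ge 2$ $$ 16N_{\mathbb{H}}(m,2s)\le \begin{cases} (s+1)^4N_{\mathbb{H}}(m-1,2s), & s\equiv 3\pmod 4,\\ (s+3)(s+1)^3N_{\mathbb{H}}(m-1,2s), & s\equiv 1\pmod 4,\\ (s+2)^3\bigl(sN_{\mathbb{H}}(m-1,2s)+1\bigr), & s\equiv 2\pmod 4,\\ (s+4)(s+2)^2\bigl(sN_{\mathbb{H}}(m-1,2s)+1\bigr), & s\equiv 0\pmod 4. \end{cases}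 $$ In particular, for all integers $s\ge 2$, $$ 16N_{\mathbb{H}}(2,2s)\le \begin{cases} (s+1)^4, & s\equiv 3\pmod 4,\\ (s+3)(s+1)^3, & s\equiv 1\pmod 4,\\ (s+2)^3(s+1), & s\equiv 2\pmod 4,\\ (s+4)(s+2)^2(s+1), & s\equiv 0\pmod 4, \end{cases} $$ and asymptotically $N_{\mathbb{H}}(2,2s)\lesssim \frac{1}{16}s^4$ as $s\to\infty$; that is, for every $\varepsilon>0$ one has $N_{\mathbb{H}}(2,2s)\le(1+\varepsilon)\frac{s^4}{16}$ for all sufficiently large $s$. -/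

import Mathlib

/-- The quaternionic space `ℍ^m` of columns with the norm `‖x‖_p = (∑ |ξ_i| ^ p) ^ (1 / p)`. It is a
right `ℍ`-linear space, that is, a module over the opposite ring `ℍᵐᵒᵖ`, the scalars acting by
`x ↦ (ξ_i * α)_i`. -/
abbrev QuatLp (p : ENNReal) (m : ℕ) : Type := PiLp p (fun _ : Fin m => Quaternion ℝ)

/-- There is an isometric embedding of `ℓ_{2;ℍ}^m` into `ℓ_{p;ℍ}^n`: a (right) `ℍ`-linear map which
preserves the norm. -/
def HasQuatIsometricEmbedding (m p n : ℕ) : Prop :=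
  ∃ f : QuatLp 2 m →ₗ[(Quaternion ℝ)ᵐᵒᵖ] QuatLp (p : ENNReal) n, ∀ y : QuatLp 2 m, ‖f y‖ = ‖y‖

/-- `N_ℍ(m, p)`: the minimal `n` such that an isometric embedding of `ℓ_{2;ℍ}^m` into `ℓ_{p;ℍ}^n`
exists (the value is meaningful only when some such `n` exists). -/
noncomputable def quatN (m p : ℕ) : ℕ :=
  sInf {n : ℕ | HasQuatIsometricEmbedding m p n}

/-! By right linearity, an embedding is a family of forms `x ↦ ∑ c_i x_i`. After absorbing
nonnegative weights through `2s`-th roots, it is a cubature identity `∑ w_k |c_k · x|^(2s) = C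
|x|^(2s)` (`HasQuatIsometricEmbedding.exists_coeff`, `hasQuatIsometricEmbedding_card`).

Passing from `ℍ^M` to `ℍ^(M+1)` is a product construction. On the unit sphere of `ℍ^(M+1)`, with
points `(y, η)`, the variable `t = |y|²` has density proportional to `t^(2M-1) (1 - t)`. The new
forms are `√t (c_k · y) + √(1-t) |c_k| u η`, with `t` a quadrature node for this density and `u` a
node of a design on `S³`. The average over `u` is a Narayana polynomial in the two squared norms
(`sum_norm_smul_add_smul_mul_pow`). The sum over `k` follows by applying the Laplacian to the given
identity (`sum_norm_pow_of_le`), and the sum over `t` is a Beta integral. The three constants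
multiply to a fixed multiple of `s.choose i` (`narayana_mul_moment`), so the binomial theorem
rebuilds `(|y|² + |η|²)^s` (`sum_norm_pow_product`).

Only degree `s` is needed in `u` and in `t`. The design costs about `s · s/2 · s/4` nodes and the
quadrature about `s/2`, whence `s^4/16`. For even `s`, Gauss quadrature would need `s/2 + 1` nodes.
Radau quadrature uses `s/2` interior nodes and `t = 0`, where `|c_k| u η` has norm `|c_k| |η|`, so
all forms at that node merge into a single one. -/

/-! ### Gauss and Gauss–Radau quadrature for positive functionals -/

open Polynomial in
/-- A linear functional on real polynomials which is positive on the nonzero polynomials that are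
nonnegative on `[0, 1]`. -/
def IsPositiveOnUnitInterval (L : ℝ[X] →ₗ[ℝ] ℝ) : Prop :=
  ∀ p : ℝ[X], p ≠ 0 → (∀ t ∈ Set.Icc (0 : ℝ) 1, 0 ≤ p.eval t) → 0 < L p

namespace IsPositiveOnUnitInterval
open Polynomial

variable {L : ℝ[X] →ₗ[ℝ] ℝ}

/-- Multiplying by a nonzero polynomial that is nonnegative on `[0, 1]` preserves positivity. -/
lemma comp_mul (hL : IsPositiveOnUnitInterval L) {q : ℝ[X]} (hq : q ≠ 0)
    (hq0 : ∀ t ∈ Set.Icc (0 : ℝ) 1, 0 ≤ q.eval t) :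
    IsPositiveOnUnitInterval (L ∘ₗ LinearMap.mulLeft ℝ q) := by
  intro p hp hp0
  refine hL _ (mul_ne_zero hq hp) fun t ht => ?_
  rw [LinearMap.mulLeft_apply, eval_mul]
  exact mul_nonneg (hq0 t ht) (hp0 t ht)

lemma mul_self_pos (hL : IsPositiveOnUnitInterval L) {p : ℝ[X]} (hp : p ≠ 0) :
    0 < L (p * p) :=
  hL _ (mul_ne_zero hp hp) fun t _ => by rw [eval_mul]; exact mul_self_nonneg _

/-- The inner product `⟪p, q⟫ = L (p q)` on polynomials of degree less than `N`. -/
@[reducible] noncomputable def core (hL : IsPositiveOnUnitInterval L) (N : ℕ) :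
    InnerProductSpace.Core ℝ (degreeLT ℝ N) where
  inner p q := L ((p : ℝ[X]) * (q : ℝ[X]))
  conj_inner_symm p q := by simp [mul_comm]
  re_inner_nonneg p := by
    by_cases hp : (p : ℝ[X]) = 0
    · simp [hp]
    · simpa using (hL.mul_self_pos hp).le
  add_left p q r := by simp [add_mul]
  smul_left p q c := by simp
  definite p h := by
    by_contra hp
    exact (hL.mul_self_pos (p := (p : ℝ[X])) (by simpa using hp)).ne' h

/-- Existence of the Gauss quadrature with `N` nodes, exact for degree less than `2 * N`. -/
theorem exists_gauss (hL : IsPositiveOnUnitInterval L) (N : ℕ) :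
    ∃ x w : Fin N → ℝ, (∀ i, 0 < x i) ∧ (∀ i, x i ≤ 1) ∧ (∀ i, 0 ≤ w i) ∧
      ∀ p : ℝ[X], p.natDegree < 2 * N → ∑ i, w i * p.eval (x i) = L p := by
  let c := hL.core N
  let : NormedAddCommGroup (degreeLT ℝ N) := c.toNormedAddCommGroup
  let : InnerProductSpace ℝ (degreeLT ℝ N) := InnerProductSpace.ofCore c.toCore
  have inner_eq : ∀ p q : degreeLT ℝ N, inner ℝ p q = L ((p : ℝ[X]) * (q : ℝ[X])) := fun _ _ => rfl
  have : FiniteDimensional ℝ (degreeLT ℝ N) :=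
    Module.Finite.equiv (degreeLTEquiv ℝ N).symm
  have hrank : Module.finrank ℝ (degreeLT ℝ N) = N := by
    rw [(degreeLTEquiv ℝ N).finrank_eq]; simp
  let B : LinearMap.BilinForm ℝ (degreeLT ℝ N) :=
    LinearMap.mk₂ ℝ (fun p q => L (X * ((p : ℝ[X]) * (q : ℝ[X]))))
      (by intros; simp [add_mul, mul_add]) (by intros; simp)
      (by intros; simp [mul_add]) (by intros; simp)
  have hB : ∀ p q, B p q = L (X * ((p : ℝ[X]) * (q : ℝ[X]))) := fun _ _ => rfl
  let B₀ : LinearMap.BilinForm ℝ (degreeLT ℝ N) :=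
    LinearMap.mk₂ ℝ (fun p q => L ((p : ℝ[X]) * (q : ℝ[X])))
      (by intros; simp [add_mul]) (by intros; simp)
      (by intros; simp [mul_add]) (by intros; simp)
  have hB₀ : ∀ p q, B₀ p q = inner ℝ p q := fun _ _ => rfl
  have hnd : B₀.Nondegenerate :=
    (LinearMap.BilinForm.nondegenerate_iff B₀ (fun p => by
        rw [hB₀]; exact real_inner_self_nonneg)
      ⟨fun p q => by simp only [hB₀]; exact real_inner_comm q p⟩).2 fun p => by
        rw [hB₀]; exact inner_self_eq_zero (𝕜 := ℝ)
  -- `T` is multiplication by `X` compressed to degree less than `N`, the Jacobi operator. Its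
  -- eigenvalues are the nodes, and the squared coordinates of `1` in its eigenbasis are the
  -- weights.
  let T : degreeLT ℝ N →ₗ[ℝ] degreeLT ℝ N := B.symmCompOfNondegenerate B₀ hnd
  have hT : ∀ p q, inner ℝ (T p) q = L (X * ((p : ℝ[X]) * (q : ℝ[X]))) := fun p q => by
    rw [← hB, ← hB₀]
    exact LinearMap.BilinForm.symmCompOfNondegenerate_left_apply B hnd q p
  have hsymm : T.IsSymmetric := fun p q => by
    rw [hT, real_inner_comm, hT, mul_comm (p : ℝ[X])]
  set e := hsymm.eigenvectorBasis hrank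
  set x := hsymm.eigenvalues hrank
  have hTe : ∀ i, T (e i) = x i • e i := fun i =>
    hsymm.apply_eigenvectorBasis hrank i
  have he1 : ∀ i, inner ℝ (e i) (e i) = 1 := fun i => by
    rw [real_inner_self_eq_norm_sq, e.norm_eq_one, one_pow]
  have hxe : ∀ i, x i = L (X * ((e i : ℝ[X]) * (e i : ℝ[X]))) := fun i => by
    rw [← hT, hTe, real_inner_smul_left, he1, mul_one]
  have hene : ∀ i, (e i : ℝ[X]) ≠ 0 := fun i h => by
    have := he1 i
    rw [inner_eq, h] at this
    simp at this
  have hmem : ∀ k < N, (X ^ k : ℝ[X]) ∈ degreeLT ℝ N := fun k hk => by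
    rw [mem_degreeLT, degree_X_pow]; exact_mod_cast hk
  rcases Nat.eq_zero_or_pos N with hN | hN
  · subst hN
    exact ⟨fun _ => 0, fun _ => 0, fun i => i.elim0, fun i => i.elim0, fun i => i.elim0,
      fun p hp => absurd hp (by simp)⟩
  let m : ∀ k, k < N → degreeLT ℝ N := fun k hk => ⟨X ^ k, hmem k hk⟩
  -- The compression is invisible as long as the degree stays below `N`: there `T` really maps `X ^
  -- k` to `X ^ (k + 1)`.
  have hpow : ∀ k (hk : k < N) i, inner ℝ (m k hk) (e i) = x i ^ k * inner ℝ (m 0 hN) (e i) := by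
    intro k
    induction k with
    | zero => intro hk i; simp
    | succ k ih =>
      intro hk i
      have h1 : inner ℝ (m (k + 1) hk) (e i) = inner ℝ (T (m k (Nat.lt_of_succ_lt hk))) (e i) := by
        rw [hT, inner_eq]
        congr 1
        simp only [m]
        ring
      rw [h1, hsymm, hTe, real_inner_smul_right, ih (Nat.lt_of_succ_lt hk), pow_succ]
      ring
  refine ⟨x, fun i => inner ℝ (m 0 hN) (e i) ^ 2, fun i => ?_, fun i => ?_,
    fun i => sq_nonneg _, fun p hp => ?_⟩
  · rw [hxe]
    refine hL _ (mul_ne_zero X_ne_zero (mul_ne_zero (hene i) (hene i))) fun t ht => ?_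
    simp only [eval_mul, eval_X]
    exact mul_nonneg ht.1 (mul_self_nonneg _)
  · have h1 : (1 : ℝ) - x i = L ((1 - X) * ((e i : ℝ[X]) * (e i : ℝ[X]))) := by
      rw [sub_mul, map_sub, ← hxe, one_mul, ← inner_eq, he1]
    have hX : (1 - X : ℝ[X]) ≠ 0 := fun h => by
      have := congrArg (eval 0) h
      simp at this
    have : 0 < L ((1 - X) * ((e i : ℝ[X]) * (e i : ℝ[X]))) := by
      refine hL _ (mul_ne_zero hX (mul_ne_zero (hene i) (hene i))) fun t ht => ?_
      simp only [eval_mul, eval_X, eval_sub, eval_one]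
      exact mul_nonneg (sub_nonneg.2 ht.2) (mul_self_nonneg _)
    linarith
  · have hmono : ∀ k < 2 * N, ∑ i, inner ℝ (m 0 hN) (e i) ^ 2 * x i ^ k = L (X ^ k) := by
      intro k hk
      by_cases h : k < N
      · have h1 : L (X ^ k) = inner ℝ (m k h) (m 0 hN) := by
          rw [inner_eq]; simp [m]
        rw [h1, ← e.sum_inner_mul_inner]
        refine Finset.sum_congr rfl fun i _ => ?_
        rw [hpow k h, real_inner_comm (m 0 hN) (e i)]
        ring
      -- One factor `X` is carried by `T`, and the other two exponents `N - 1` and `j` stay below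
      -- `N`. This is what extends exactness to degree `2 * N - 1`.
      · obtain ⟨j, rfl⟩ : ∃ j, k = (N - 1) + j + 1 := ⟨k - N, by omega⟩
        have hj : j < N := by omega
        have h1 : L (X ^ ((N - 1) + j + 1)) = inner ℝ (T (m (N - 1) (Nat.sub_lt hN one_pos))) (m j hj) := by
          rw [hT]
          congr 1
          simp only [m]
          ring
        rw [h1, ← e.sum_inner_mul_inner]
        refine Finset.sum_congr rfl fun i _ => ?_
        rw [hsymm, hTe, real_inner_smul_right, hpow (N - 1) (Nat.sub_lt hN one_pos),
          real_inner_comm (m j hj) (e i), hpow j hj]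
        ring
    rw [p.as_sum_range' _ hp]
    simp only [eval_finsetSum, map_sum, eval_monomial, Finset.mul_sum]
    rw [Finset.sum_comm]
    refine Finset.sum_congr rfl fun k hk => ?_
    rw [← C_mul_X_pow_eq_monomial, ← smul_eq_C_mul, map_smul, smul_eq_mul,
      ← hmono k (Finset.mem_range.1 hk), Finset.mul_sum]
    exact Finset.sum_congr rfl fun i _ => by ring

/-- Existence of the Gauss–Radau quadrature with `N` interior nodes and the node `0`, exact for
degree at most `2 * N`. -/
theorem exists_radau (hL : IsPositiveOnUnitInterval L) (N : ℕ) :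
    ∃ (x w : Fin N → ℝ) (w₀ : ℝ), (∀ i, 0 < x i) ∧ (∀ i, x i ≤ 1) ∧ (∀ i, 0 ≤ w i) ∧ 0 ≤ w₀ ∧
      ∀ p : ℝ[X], p.natDegree ≤ 2 * N → w₀ * p.eval 0 + ∑ i, w i * p.eval (x i) = L p := by
  have hLX : IsPositiveOnUnitInterval (L ∘ₗ LinearMap.mulLeft ℝ X) :=
    hL.comp_mul X_ne_zero fun t ht => by simpa using ht.1
  obtain ⟨x, w, hx0, hx1, hw, hq⟩ := hLX.exists_gauss N
  -- Split `p = X * p.divX + p(0)` and apply the Gauss rule of the functional `p ↦ L (X * p)` to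
  -- `p.divX`. The weights get divided by the nodes, and the weight at `0` is forced by exactness on
  -- constants.
  have key : ∀ p : ℝ[X], p.natDegree ≤ 2 * N →
      (L 1 - ∑ i, w i / x i) * p.eval 0 + ∑ i, w i / x i * p.eval (x i) = L p := by
    intro p hp
    obtain rfl | hN := Nat.eq_zero_or_pos N
    · rw [eq_C_of_natDegree_le_zero hp, ← mul_one (C _), ← smul_eq_C_mul]
      simp [mul_comm]
    have h1 := hq p.divX (by
      rw [natDegree_divX_eq_natDegree_tsub_one]; omega)
    simp only [LinearMap.comp_apply, LinearMap.mulLeft_apply] at h1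
    have h2 : L p = L (X * p.divX) + p.eval 0 * L 1 := by
      conv_lhs => rw [← X_mul_divX_add p]
      rw [map_add, ← mul_one (C _), ← smul_eq_C_mul, map_smul, smul_eq_mul, coeff_zero_eq_eval_zero]
    have h3 : ∀ i, w i / x i * p.eval (x i) = w i * p.divX.eval (x i) + w i / x i * p.eval 0 := by
      intro i
      conv_lhs => rw [← X_mul_divX_add p]
      have := (hx0 i).ne'
      simp only [eval_add, eval_mul, eval_X, eval_C, coeff_zero_eq_eval_zero]
      field_simp
    rw [h2, ← h1, Finset.sum_congr rfl fun i _ => h3 i, Finset.sum_add_distrib,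
      ← Finset.sum_mul]
    ring
  refine ⟨x, fun i => w i / x i, L 1 - ∑ i, w i / x i, hx0, hx1,
    fun i => div_nonneg (hw i) (hx0 i).le, ?_, key⟩
  -- `P` vanishes at the interior nodes and equals `1` at `0`, so exactness on `P * P` identifies
  -- the weight at `0` with `L (P * P)`.
  set P : ℝ[X] := ∏ i, (1 - C (x i)⁻¹ * X) with hP
  have hPdeg : (P * P).natDegree ≤ 2 * N := by
    have : P.natDegree ≤ N := by
      refine (natDegree_prod_le _ _).trans ?_
      refine (Finset.sum_le_card_nsmul _ _ 1 fun i _ => ?_).trans (by simp)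
      compute_degree
    exact natDegree_mul_le.trans (by omega)
  have hP0 : P.eval 0 = 1 := by simp [hP, eval_prod]
  have hPx : ∀ i, P.eval (x i) = 0 := fun i => by
    rw [hP, eval_prod]
    exact Finset.prod_eq_zero (Finset.mem_univ i) (by simp [(hx0 i).ne'])
  have h := key _ hPdeg
  simp only [eval_mul, hP0, hPx, mul_one, mul_zero, Finset.sum_const_zero, add_zero] at h
  rw [h]
  exact (hL.mul_self_pos fun h0 => by simp [h0] at hP0).le

end IsPositiveOnUnitInterval

/-! ### Integration over the unit interval and Beta integrals -/

open Polynomial in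
/-- The functional `p ↦ ∫ t in 0..1, p t`. -/
noncomputable def unitIntervalIntegral : ℝ[X] →ₗ[ℝ] ℝ where
  toFun p := ∫ t in (0 : ℝ)..1, p.eval t
  map_add' p q := by
    simp only [eval_add]
    exact intervalIntegral.integral_add (p.continuous.intervalIntegrable _ _)
      (q.continuous.intervalIntegrable _ _)
  map_smul' c p := by simp

open Polynomial in
lemma isPositiveOnUnitInterval_unitIntervalIntegral :
    IsPositiveOnUnitInterval unitIntervalIntegral := by
  intro p hp hp0
  obtain ⟨c, hc, hc'⟩ := ((Set.Icc_infinite (zero_lt_one' ℝ)).sdiff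
    (p.roots.toFinset.finite_toSet)).nonempty
  refine intervalIntegral.integral_pos zero_lt_one p.continuous.continuousOn
    (fun t ht => hp0 t ⟨ht.1.le, ht.2⟩) ⟨c, hc, (hp0 c hc).lt_of_ne' fun h => hc' ?_⟩
  simpa [hp] using h

-- Beta integral: `t ^ (i + 1) * (1 - t) ^ (j + 1)` vanishes at both ends, so integrating its
-- derivative trades a factor `1 - t` for a factor `t`.
open Polynomial in
lemma unitIntervalIntegral_X_pow_mul (i j : ℕ) :
    unitIntervalIntegral (X ^ i * (1 - X) ^ j) =
      (i.factorial * j.factorial : ℝ) / (i + j + 1).factorial := by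
  induction j generalizing i with
  | zero =>
    simp only [unitIntervalIntegral, LinearMap.coe_mk, AddHom.coe_mk, pow_zero, mul_one, eval_pow,
      eval_X, integral_pow, Nat.factorial_zero, Nat.cast_one, add_zero, Nat.factorial_succ]
    have : (i.factorial : ℝ) ≠ 0 := by positivity
    push_cast
    field_simp
    simp
  | succ j ih =>
    have hder : ∀ t : ℝ, HasDerivAt (fun t => t ^ (i + 1) * (1 - t) ^ (j + 1))
        ((i + 1) * (t ^ i * (1 - t) ^ (j + 1)) - (j + 1) * (t ^ (i + 1) * (1 - t) ^ j)) t := by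
      intro t
      refine ((hasDerivAt_pow (i + 1) t).mul
        (((hasDerivAt_id t).const_sub 1).pow (j + 1))).congr_deriv ?_
      simp
      ring
    have hint : ∀ a b : ℕ, IntervalIntegrable (fun t : ℝ => t ^ a * (1 - t) ^ b)
        MeasureTheory.volume 0 1 := fun a b => by
      apply Continuous.intervalIntegrable
      fun_prop
    have h := intervalIntegral.integral_eq_sub_of_hasDerivAt (a := 0) (b := 1)
      (fun t _ => hder t) (((hint _ _).const_mul _).sub ((hint _ _).const_mul _))
    rw [intervalIntegral.integral_sub ((hint _ _).const_mul _) ((hint _ _).const_mul _),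
      intervalIntegral.integral_const_mul, intervalIntegral.integral_const_mul] at h
    have ih' := ih (i + 1)
    simp only [unitIntervalIntegral, LinearMap.coe_mk, AddHom.coe_mk, eval_mul, eval_pow,
      eval_X, eval_sub, eval_one] at ih' ⊢
    rw [ih'] at h
    have h2 : ((i : ℝ) + 1) ≠ 0 := by positivity
    rw [show i + 1 + j + 1 = i + (j + 1) + 1 by ring, Nat.factorial_succ i] at h
    rw [Nat.factorial_succ j, ← mul_right_inj' h2]
    simp at h
    push_cast
    linear_combination h

open Polynomial in
lemma natDegree_X_pow_mul_one_sub_X_pow_le (i j : ℕ) :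
    (X ^ i * (1 - X) ^ j : ℝ[X]).natDegree ≤ i + j := by
  refine natDegree_mul_le.trans (add_le_add (natDegree_X_pow_le i) ?_)
  have : (1 - X : ℝ[X]).natDegree ≤ 1 := by compute_degree
  simpa using natDegree_pow_le_of_le j this
-- Averages over roots of unity
namespace IsPrimitiveRoot
open ComplexConjugate

variable {ζ : ℂ} {n : ℕ}

/-- Orthogonality of characters: the averages of `z ^ i * conj z ^ j` over the `n`-th roots of
unity. -/
lemma sum_pow_mul_conj_pow (hζ : IsPrimitiveRoot ζ n) {i j : ℕ} (hi : i < n) (hj : j < n) :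
    ∑ q : Fin n, (ζ ^ (q : ℕ)) ^ i * conj (ζ ^ (q : ℕ)) ^ j = if i = j then (n : ℂ) else 0 := by
  have hn : n ≠ 0 := by omega
  have hconj : conj ζ = ζ⁻¹ := by
    rw [Complex.inv_def, Complex.normSq_eq_norm_sq, hζ.norm'_eq_one hn]
    simp
  have h0 : ζ ≠ 0 := hζ.ne_zero hn
  have hterm : ∀ q : ℕ, (ζ ^ q) ^ i * conj (ζ ^ q) ^ j = (ζ ^ i * ζ⁻¹ ^ j) ^ q := fun q => by
    rw [map_pow, hconj, mul_pow, ← pow_mul, ← pow_mul, ← pow_mul, ← pow_mul, mul_comm q i,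
      mul_comm q j]
  rw [Finset.sum_congr rfl fun (q : Fin n) _ => hterm q,
    Fin.sum_univ_eq_sum_range (fun q => (ζ ^ i * ζ⁻¹ ^ j) ^ q)]
  split_ifs with h
  · subst h
    rw [← mul_pow, mul_inv_cancel₀ h0]
    simp
  · have h1 : ζ ^ i * ζ⁻¹ ^ j ≠ 1 := fun h1 => h <| hζ.pow_inj hi hj <| by
      rw [inv_pow] at h1
      exact (mul_inv_eq_one₀ (pow_ne_zero _ h0)).1 h1
    have h2 : (ζ ^ i * ζ⁻¹ ^ j) ^ n = 1 := by
      rw [mul_pow, ← pow_mul, ← pow_mul, mul_comm i, mul_comm j, pow_mul, pow_mul, inv_pow,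
        hζ.pow_eq_one]
      simp
    rw [geom_sum_eq h1, h2, sub_self, zero_div]

/-- Expanding `(A + zB)^l` times its conjugate, orthogonality of characters leaves only the diagonal
terms. Both exponents are at most `l`, so `l < n` prevents aliasing. -/
lemma sum_norm_add_pow (hζ : IsPrimitiveRoot ζ n) {l : ℕ} (hl : l < n) (A B : ℂ) :
    ∑ q : Fin n, ‖A + ζ ^ (q : ℕ) * B‖ ^ (2 * l) =
      n * ∑ i ∈ Finset.range (l + 1), (l.choose i : ℝ) ^ 2 * (‖B‖ ^ 2) ^ i * (‖A‖ ^ 2) ^ (l - i) := by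
  have hsq : ∀ z : ℂ, (‖z‖ : ℂ) ^ 2 = z * conj z := fun z => by
    rw [Complex.mul_conj, Complex.normSq_eq_norm_sq, Complex.ofReal_pow]
  apply Complex.ofReal_injective
  rw [Complex.ofReal_sum]
  have hterm : ∀ q : Fin n, ((‖A + ζ ^ (q : ℕ) * B‖ ^ (2 * l) : ℝ) : ℂ) =
      ∑ i ∈ Finset.range (l + 1), ∑ j ∈ Finset.range (l + 1),
        ((ζ ^ (q : ℕ)) ^ i * conj (ζ ^ (q : ℕ)) ^ j) *
          (l.choose i * B ^ i * A ^ (l - i) * (l.choose j * conj B ^ j * conj A ^ (l - j))) := by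
    intro q
    rw [pow_mul, Complex.ofReal_pow, Complex.ofReal_pow, hsq, mul_pow, ← map_pow, add_comm, add_pow, map_sum,
      Finset.sum_mul_sum]
    refine Finset.sum_congr rfl fun i _ => Finset.sum_congr rfl fun j _ => ?_
    simp only [map_mul, map_pow, map_natCast]
    ring
  rw [Finset.sum_congr rfl fun q _ => hterm q, Finset.sum_comm, Complex.ofReal_mul,
    Complex.ofReal_natCast, Complex.ofReal_sum, Finset.mul_sum]
  refine Finset.sum_congr rfl fun i hi => ?_
  rw [Finset.sum_comm]
  have hi' : i < n := by have := Finset.mem_range.1 hi; omega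
  rw [Finset.sum_eq_single_of_mem i hi]
  · rw [← Finset.sum_mul, hζ.sum_pow_mul_conj_pow hi' hi', if_pos rfl]
    push_cast
    rw [hsq, hsq]
    ring
  · intro j hj hji
    have hj' : j < n := by have := Finset.mem_range.1 hj; omega
    rw [← Finset.sum_mul, hζ.sum_pow_mul_conj_pow hi' hj', if_neg hji.symm, zero_mul]

/-- With `2 Re z = z + conj z`, only the balanced term of the binomial expansion survives. Hence odd
powers average to zero and even ones produce a central binomial coefficient. -/
lemma sum_re_pow (hζ : IsPrimitiveRoot ζ n) {j : ℕ} (hj : j < n) (W : ℂ) :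
    ((∑ q : Fin n, (2 * (ζ ^ (q : ℕ) * W).re) ^ j : ℝ) : ℂ) =
      ∑ a ∈ Finset.range (j + 1), (if a = j - a then (n : ℂ) else 0) *
          (W ^ a * conj W ^ (j - a) * j.choose a) := by
  rw [Complex.ofReal_sum]
  have hterm : ∀ q : Fin n, (((2 * (ζ ^ (q : ℕ) * W).re) ^ j : ℝ) : ℂ) =
      ∑ a ∈ Finset.range (j + 1), ((ζ ^ (q : ℕ)) ^ a * conj (ζ ^ (q : ℕ)) ^ (j - a)) *
          (W ^ a * conj W ^ (j - a) * j.choose a) := by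
    intro q
    rw [Complex.ofReal_pow, ← Complex.add_conj, add_pow]
    refine Finset.sum_congr rfl fun i _ => ?_
    simp only [map_mul, map_pow]
    ring
  rw [Finset.sum_congr rfl fun q _ => hterm q, Finset.sum_comm]
  refine Finset.sum_congr rfl fun a ha => ?_
  have := Finset.mem_range.1 ha
  rw [← Finset.sum_mul, hζ.sum_pow_mul_conj_pow (by omega) (by omega)]

lemma sum_re_pow_even (hζ : IsPrimitiveRoot ζ n) {l : ℕ} (hl : 2 * l < n) (W : ℂ) :
    ∑ q : Fin n, (ζ ^ (q : ℕ) * W).re ^ (2 * l) = n * (l.centralBinom / 4 ^ l * ‖W‖ ^ (2 * l)) := by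
  have h : ∑ q : Fin n, (2 * (ζ ^ (q : ℕ) * W).re) ^ (2 * l) =
      n * (l.centralBinom * ‖W‖ ^ (2 * l)) := by
    apply Complex.ofReal_injective
    rw [hζ.sum_re_pow hl, Finset.sum_eq_single_of_mem l (by simp; omega)]
    · rw [if_pos (by omega), show 2 * l - l = l by omega, ← mul_pow, Complex.mul_conj,
        Complex.normSq_eq_norm_sq, Nat.centralBinom, pow_mul]
      push_cast
      ring
    · intro a _ ha
      rw [if_neg (by omega), zero_mul]
  simp only [mul_pow, ← Finset.mul_sum] at h
  rw [pow_mul, show (2 : ℝ) ^ 2 = 4 by norm_num] at h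
  field_simp
  linear_combination h

lemma sum_re_pow_odd (hζ : IsPrimitiveRoot ζ n) {l : ℕ} (hl : 2 * l + 1 < n) (W : ℂ) :
    ∑ q : Fin n, (ζ ^ (q : ℕ) * W).re ^ (2 * l + 1) = 0 := by
  have h : ∑ q : Fin n, (2 * (ζ ^ (q : ℕ) * W).re) ^ (2 * l + 1) = 0 := by
    apply Complex.ofReal_injective
    rw [hζ.sum_re_pow hl, Complex.ofReal_zero]
    refine Finset.sum_eq_zero fun a _ => ?_
    rw [if_neg (by omega), zero_mul]
  simp only [mul_pow, ← Finset.mul_sum] at h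
  exact (mul_eq_zero.1 h).resolve_left (by positivity)

end IsPrimitiveRoot

/-! ### Designs on the sphere of unit quaternions -/

/-- The quaternion `z₁ + z₂ j` with the complex coordinates `z₁`, `z₂`. -/
def Quaternion.ofComplexPair (z₁ z₂ : ℂ) : Quaternion ℝ := ⟨z₁.re, z₁.im, z₂.re, z₂.im⟩

open ComplexConjugate in
lemma Quaternion.inner_ofComplexPair (z₁ z₂ w₁ w₂ : ℂ) :
    inner ℝ (ofComplexPair z₁ z₂) (ofComplexPair w₁ w₂) = (z₁ * conj w₁ + z₂ * conj w₂).re := by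
  rw [Quaternion.inner_def, Quaternion.re_mul, Quaternion.re_star, Quaternion.imI_star,
    Quaternion.imJ_star, Quaternion.imK_star]
  simp [ofComplexPair]
  ring

lemma Quaternion.norm_ofComplexPair_sq (z₁ z₂ : ℂ) :
    ‖ofComplexPair z₁ z₂‖ ^ 2 = ‖z₁‖ ^ 2 + ‖z₂‖ ^ 2 := by
  rw [← real_inner_self_eq_norm_sq, inner_ofComplexPair, Complex.mul_conj, Complex.mul_conj,
    Complex.normSq_eq_norm_sq, Complex.normSq_eq_norm_sq]
  norm_cast

lemma Quaternion.exists_eq_ofComplexPair (v : Quaternion ℝ) : ∃ z₁ z₂, v = ofComplexPair z₁ z₂ :=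
  ⟨⟨v.re, v.imI⟩, ⟨v.imJ, v.imK⟩, rfl⟩

open Polynomial in
/-- The quadrature on `[0, 1]` turns the averages over the tori of the sphere `S³` into powers of
the norm. -/
lemma sum_choose_sq_mul_gauss {G l : ℕ} (hl : l < 2 * G) (x w : Fin G → ℝ)
    (hq : ∀ p : ℝ[X], p.natDegree < 2 * G → ∑ i, w i * p.eval (x i) = unitIntervalIntegral p)
    (a b : ℝ) :
    ∑ k, w k * ∑ i ∈ Finset.range (l + 1), (l.choose i : ℝ) ^ 2 * (x k * a) ^ i *
      ((1 - x k) * b) ^ (l - i) = (a + b) ^ l / (l + 1) := by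
  simp only [Finset.mul_sum]
  rw [Finset.sum_comm, add_pow, Finset.sum_div]
  refine Finset.sum_congr rfl fun i hi => ?_
  have hi' := Finset.mem_range_succ_iff.1 hi
  have h := hq (X ^ i * (1 - X) ^ (l - i))
    ((natDegree_X_pow_mul_one_sub_X_pow_le i (l - i)).trans_lt (by omega))
  rw [unitIntervalIntegral_X_pow_mul] at h
  simp only [eval_mul, eval_pow, eval_X, eval_sub, eval_one] at h
  have e1 : ∀ k, w k * ((l.choose i : ℝ) ^ 2 * (x k * a) ^ i * ((1 - x k) * b) ^ (l - i)) =
      ((l.choose i : ℝ) ^ 2 * a ^ i * b ^ (l - i)) * (w k * (x k ^ i * (1 - x k) ^ (l - i))) :=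
    fun k => by rw [mul_pow, mul_pow]; ring
  rw [Finset.sum_congr rfl fun k _ => e1 k, ← Finset.mul_sum, h,
    show i + (l - i) + 1 = l + 1 by omega]
  -- The Beta value cancels one of the two binomial factors, leaving `l.choose i / (l + 1)` and thus
  -- the binomial theorem.
  have h3 : ((l.choose i * i.factorial * (l - i).factorial : ℕ) : ℝ) = l.factorial := by
    rw [Nat.choose_mul_factorial_mul_factorial hi']
  rw [Nat.factorial_succ]
  have h4 : (l.factorial : ℝ) ≠ 0 := by positivity
  push_cast at h3 ⊢
  field_simp
  rw [← h3]
  ring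

open ComplexConjugate in
/-- A weighted cubature formula of degree `2 * r - 1` on the unit sphere of the quaternions, with
`2 * r ^ 2 * G` nodes, `r ≤ 2 * G`. -/
theorem exists_quaternion_design {r G : ℕ} (hr : 0 < r) (hG : r ≤ 2 * G) :
    ∃ (u : Fin (2 * r) × Fin r × Fin G → Quaternion ℝ) (w : Fin (2 * r) × Fin r × Fin G → ℝ),
      (∀ i, ‖u i‖ = 1) ∧ (∀ i, 0 ≤ w i) ∧
      (∀ l < r, ∀ v, ∑ i, w i * inner ℝ (u i) v ^ (2 * l) =
        l.centralBinom / (l + 1) / 4 ^ l * ‖v‖ ^ (2 * l)) ∧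
      (∀ l < r, ∀ v, ∑ i, w i * inner ℝ (u i) v ^ (2 * l + 1) = 0) := by
  obtain ⟨x, w, hx0, hx1, hw, hq⟩ := isPositiveOnUnitInterval_unitIntervalIntegral.exists_gauss G
  obtain ⟨ζ, hζ⟩ : ∃ ζ : ℂ, IsPrimitiveRoot ζ (2 * r) :=
    ⟨_, Complex.isPrimitiveRoot_exp (2 * r) (by omega)⟩
  -- The nodes use torus coordinates on `S³`: a common phase, a relative phase and `|z₁|²`, which is
  -- uniform on `[0, 1]`. The common phase meets powers of a real part up to degree `2r - 1`, so it
  -- needs `2r`-th roots. The relative phase then meets only `|W|^(2l)` with `l < r`, so `r`-th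
  -- roots suffice. What remains is a polynomial of degree `l < 2G` in `x`.
  have hξ : IsPrimitiveRoot (ζ ^ 2) r := hζ.pow (by omega) rfl
  have hζn : ‖ζ‖ = 1 := hζ.norm'_eq_one (by omega)
  have hinner : ∀ (i : Fin (2 * r) × Fin r × Fin G) (v₁ v₂ : ℂ),
      inner ℝ (Quaternion.ofComplexPair (ζ ^ (i.1 : ℕ) * ((ζ ^ 2) ^ (i.2.1 : ℕ) * √(x i.2.2)))
        (ζ ^ (i.1 : ℕ) * √(1 - x i.2.2))) (Quaternion.ofComplexPair v₁ v₂) =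
      (ζ ^ (i.1 : ℕ) * (√(1 - x i.2.2) * conj v₂ + (ζ ^ 2) ^ (i.2.1 : ℕ) *
        (√(x i.2.2) * conj v₁))).re := fun i v₁ v₂ => by
    rw [Quaternion.inner_ofComplexPair]
    congr 1
    ring
  refine ⟨fun i => Quaternion.ofComplexPair (ζ ^ (i.1 : ℕ) * ((ζ ^ 2) ^ (i.2.1 : ℕ) * √(x i.2.2)))
    (ζ ^ (i.1 : ℕ) * √(1 - x i.2.2)), fun i => w i.2.2 / (2 * r * r), fun i => ?_,
    fun i => div_nonneg (hw _) (by positivity), fun l hl v => ?_, fun l hl v => ?_⟩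
  · rw [← sq_eq_sq₀ (norm_nonneg _) zero_le_one, Quaternion.norm_ofComplexPair_sq]
    simp only [norm_mul, norm_pow, hζn, one_pow, one_mul, Complex.norm_real, Real.norm_eq_abs,
      sq_abs]
    rw [Real.sq_sqrt (hx0 _).le, Real.sq_sqrt (sub_nonneg.2 (hx1 _))]
    ring
  · obtain ⟨v₁, v₂, rfl⟩ := v.exists_eq_ofComplexPair
    simp only [hinner, Fintype.sum_prod_type]
    rw [Finset.sum_comm]
    simp only [Finset.sum_comm (s := (Finset.univ : Finset (Fin (2 * r))))]
    simp only [← Finset.mul_sum, hζ.sum_re_pow_even (show 2 * l < 2 * r by omega)]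
    rw [Finset.sum_comm]
    simp only [← Finset.mul_sum, hξ.sum_norm_add_pow hl]
    have hsum := sum_choose_sq_mul_gauss (show l < 2 * G by omega) x w hq (‖v₁‖ ^ 2) (‖v₂‖ ^ 2)
    have hterm : ∀ k, ∀ i, (l.choose i : ℝ) ^ 2 * (‖(√(x k) : ℂ) * conj v₁‖ ^ 2) ^ i *
        (‖(√(1 - x k) : ℂ) * conj v₂‖ ^ 2) ^ (l - i) = (l.choose i : ℝ) ^ 2 *
        (x k * ‖v₁‖ ^ 2) ^ i * ((1 - x k) * ‖v₂‖ ^ 2) ^ (l - i) := fun k i => by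
      simp only [norm_mul, Complex.norm_real, Real.norm_eq_abs, RCLike.norm_conj, mul_pow _ _ 2,
        sq_abs, Real.sq_sqrt (hx0 _).le, Real.sq_sqrt (sub_nonneg.2 (hx1 _))]
    simp only [hterm]
    rw [pow_mul ‖Quaternion.ofComplexPair v₁ v₂‖, Quaternion.norm_ofComplexPair_sq]
    have hrr : (r : ℝ) ≠ 0 := by positivity
    have e2 : ∀ k, ∀ S : ℝ, w k / (2 * r * r) * (((2 * r : ℕ) : ℝ) * (l.centralBinom / 4 ^ l *
        (r * S))) = (l.centralBinom / 4 ^ l) * (w k * S) := fun k S => by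
      push_cast
      field_simp
    simp only [e2]
    rw [← Finset.mul_sum, hsum]
    ring
  · obtain ⟨v₁, v₂, rfl⟩ := v.exists_eq_ofComplexPair
    simp only [hinner, Fintype.sum_prod_type]
    rw [Finset.sum_comm]
    simp only [Finset.sum_comm (s := (Finset.univ : Finset (Fin (2 * r))))]
    simp only [← Finset.mul_sum, hζ.sum_re_pow_odd (show 2 * l + 1 < 2 * r by omega)]
    simp

/-! ### Narayana polynomials -/

/-- Both sides are the multinomial coefficient of `s` with parts `l, l, i - l, s - i - l`, and both
vanish when `l + i > s`. -/
lemma Nat.choose_mul_centralBinom_mul_choose {s i l : ℕ} (hl : l ≤ i) :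
    s.choose (2 * l) * l.centralBinom * (s - 2 * l).choose (i - l) =
      s.choose i * i.choose l * (s - i).choose l := by
  have h1 : s.choose (2 * l) * l.centralBinom = s.choose l * (s - l).choose l := by
    rw [Nat.centralBinom, Nat.choose_mul (by omega), show 2 * l - l = l by omega]
  have h2 := Nat.choose_mul (n := s - l) hl
  have h3 := Nat.choose_mul (n := s) (k := l + i) (s := l) (by omega)
  have h4 := Nat.choose_mul (n := s) (k := l + i) (s := i) (by omega)
  rw [show l + i - l = i by omega] at h3
  rw [show l + i - i = l by omega] at h4
  have h5 : (l + i).choose l = (l + i).choose i := Nat.choose_symm_add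
  rw [h1, show s - 2 * l = s - l - l by omega, mul_assoc, ← h2, ← mul_assoc, ← h3, h5, h4]
  ring

lemma Nat.sum_choose_mul_choose_succ (m i : ℕ) :
    ∑ l ∈ Finset.range (i + 1), i.choose l * m.choose (l + 1) = (i + m).choose (i + 1) := by
  rw [add_comm i m, Nat.add_choose_eq, Finset.Nat.sum_antidiagonal_eq_sum_range_succ_mk,
    Finset.sum_range_succ' _ (i + 1)]
  simp only [Nat.sub_zero, Nat.choose_succ_self, mul_zero, add_zero]
  refine Finset.sum_congr rfl fun l hl => ?_
  rw [Nat.add_sub_add_right, Nat.choose_symm (Finset.mem_range_succ_iff.1 hl), mul_comm]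

/-- This is the coefficient of `X ^ i * Y ^ (s - i)` in the Narayana expansion. The factor `1 / (l +
1)` is absorbed into `(s - i + 1).choose (l + 1)`, after which Vandermonde's identity applies. -/
lemma sum_choose_mul_centralBinom {s i : ℕ} (hi : i ≤ s) :
    ∑ l ∈ Finset.range (i + 1), (s.choose (2 * l) : ℝ) * (l.centralBinom / (l + 1)) *
      (s - 2 * l).choose (i - l) = s.choose i * (s + 1).choose i / (i + 1) := by
  have h1 : ∀ l ∈ Finset.range (i + 1), (s.choose (2 * l) : ℝ) * (l.centralBinom / (l + 1)) *
      (s - 2 * l).choose (i - l) =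
      s.choose i / (s - i + 1 : ℕ) * (i.choose l * (s - i + 1).choose (l + 1) : ℕ) := by
    intro l hl
    have h2 := Nat.choose_mul_centralBinom_mul_choose (s := s) (Finset.mem_range_succ_iff.1 hl)
    have h3 := Nat.add_one_mul_choose_eq (s - i) l
    have h2' : (s.choose (2 * l) * l.centralBinom * (s - 2 * l).choose (i - l) : ℝ) =
      s.choose i * i.choose l * (s - i).choose l := by exact_mod_cast h2
    have h3' : ((s - i + 1 : ℕ) * (s - i).choose l : ℝ) =
      (s - i + 1).choose (l + 1) * (l + 1) := by exact_mod_cast h3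
    have h4 : ((s - i + 1 : ℕ) : ℝ) ≠ 0 := by positivity
    rw [Nat.cast_mul]
    field_simp
    linear_combination ((s - i + 1 : ℕ) : ℝ) * h2' + (s.choose i * i.choose l : ℝ) * h3'
  rw [Finset.sum_congr rfl h1, ← Finset.mul_sum, ← Nat.cast_sum, Nat.sum_choose_mul_choose_succ,
    show i + (s - i + 1) = s + 1 by omega]
  have h5 := Nat.choose_succ_right_eq (s + 1) i
  rw [show s + 1 - i = s - i + 1 by omega] at h5
  have h5' : ((s + 1).choose (i + 1) * (i + 1) : ℝ) = (s + 1).choose i * (s - i + 1 : ℕ) := by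
    exact_mod_cast h5
  have h4 : ((s - i + 1 : ℕ) : ℝ) ≠ 0 := by positivity
  field_simp
  linear_combination (s.choose i : ℝ) * h5'

/-- The expansion of the Narayana polynomials in the basis `(X Y) ^ l * (X + Y) ^ (s - 2 * l)`. -/
lemma sum_centralBinom_mul_pow (s : ℕ) (X Y : ℝ) :
    ∑ l ∈ Finset.range (s + 1), (s.choose (2 * l) : ℝ) * (l.centralBinom / (l + 1)) *
      ((X * Y) ^ l * (X + Y) ^ (s - 2 * l)) =
    ∑ i ∈ Finset.range (s + 1), (s.choose i * (s + 1).choose i / (i + 1) : ℝ) *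
      (X ^ i * Y ^ (s - i)) := by
  have h1 : ∀ l ∈ Finset.range (s + 1), (s.choose (2 * l) : ℝ) * (l.centralBinom / (l + 1)) *
      ((X * Y) ^ l * (X + Y) ^ (s - 2 * l)) =
      ∑ i ∈ Finset.range (s + 1), if l ≤ i then
        (s.choose (2 * l) : ℝ) * (l.centralBinom / (l + 1)) * (s - 2 * l).choose (i - l) *
        (X ^ i * Y ^ (s - i)) else 0 := by
    intro l _
    by_cases hl : 2 * l ≤ s
    swap
    · rw [Nat.choose_eq_zero_of_lt (by omega : s < 2 * l)]
      simp
    -- Only exponents `l ≤ i ≤ s - l` occur in `(XY)^l (X + Y)^(s - 2l)`; beyond them the binomial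
    -- coefficient vanishes.
    rw [← Finset.sum_filter, ← Finset.sum_subset (s₁ := Finset.Ico l (s - l + 1))]
    · rw [Finset.sum_Ico_eq_sum_range, add_pow, Finset.mul_sum, Finset.mul_sum,
        show s - l + 1 - l = s - 2 * l + 1 by omega]
      refine Finset.sum_congr rfl fun j hj => ?_
      have hj' := Finset.mem_range.1 hj
      rw [Nat.add_sub_cancel_left, show s - (l + j) = l + (s - 2 * l - j) by
        omega]
      rw [pow_add, pow_add]
      ring
    · intro j
      simp
      omega
    · intro j hj hj'
      simp only [Finset.mem_filter, Finset.mem_range, Finset.mem_Ico] at hj hj'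
      rw [Nat.choose_eq_zero_of_lt (by omega : s - 2 * l < j - l)]
      simp
  rw [Finset.sum_congr rfl h1, Finset.sum_comm]
  refine Finset.sum_congr rfl fun i hi => ?_
  have hi' := Finset.mem_range_succ_iff.1 hi
  rw [← Finset.sum_filter, ← sum_choose_mul_centralBinom hi', Finset.sum_mul]
  refine Finset.sum_congr ?_ fun _ _ => rfl
  ext l
  simp
  omega

/-! ### Averaging over a quaternionic design -/

lemma Finset.sum_range_two_mul {M : Type*} [AddCommMonoid M] (f : ℕ → M) (n : ℕ) :
    ∑ k ∈ range (2 * n), f k = ∑ l ∈ range n, (f (2 * l) + f (2 * l + 1)) := by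
  induction n with
  | zero => simp
  | succ n ih => rw [mul_add, mul_one, sum_range_succ, sum_range_succ, sum_range_succ, ih, add_assoc]

/-- The dependence on `u` is affine in one real inner product, so the `s`-th power of this
expression has degree only `s` in `u`. -/
lemma Quaternion.norm_smul_add_smul_mul_sq (a b : ℝ) (u z η : Quaternion ℝ) (hu : ‖u‖ = 1) :
    ‖a • z + b • (u * η)‖ ^ 2 =
      a ^ 2 * ‖z‖ ^ 2 + b ^ 2 * ‖η‖ ^ 2 + 2 * a * b * inner ℝ u (z * star η) := by
  have h : inner ℝ z (u * η) = inner ℝ u (z * star η) := by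
    rw [real_inner_comm, Quaternion.inner_def, Quaternion.inner_def, star_mul, star_star,
      mul_assoc]
  rw [norm_add_sq_real, norm_smul, norm_smul, norm_mul, hu, real_inner_smul_left,
    real_inner_smul_right, h, mul_pow, mul_pow, one_mul, Real.norm_eq_abs, Real.norm_eq_abs,
    sq_abs, sq_abs]
  ring

/-- Averaging `‖a z + b u η‖ ^ (2 * s)` over a design of unit quaternions `u`. -/
lemma sum_norm_smul_add_smul_mul_pow {ι : Type*} [Fintype ι] {r s : ℕ} (hs : s < 2 * r)
    (u : ι → Quaternion ℝ) (w : ι → ℝ) (hu : ∀ i, ‖u i‖ = 1)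
    (heven : ∀ l < r, ∀ v, ∑ i, w i * inner ℝ (u i) v ^ (2 * l) =
        l.centralBinom / (l + 1) / 4 ^ l * ‖v‖ ^ (2 * l))
    (hodd : ∀ l < r, ∀ v, ∑ i, w i * inner ℝ (u i) v ^ (2 * l + 1) = 0)
    (a b : ℝ) (z η : Quaternion ℝ) :
    ∑ k, w k * ‖a • z + b • (u k * η)‖ ^ (2 * s) =
      ∑ i ∈ Finset.range (s + 1), (s.choose i * (s + 1).choose i / (i + 1) : ℝ) *
        ((a ^ 2 * ‖z‖ ^ 2) ^ i * (b ^ 2 * ‖η‖ ^ 2) ^ (s - i)) := by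
  set X := a ^ 2 * ‖z‖ ^ 2
  set Y := b ^ 2 * ‖η‖ ^ 2
  -- The range is padded to `2 * (s + 1)` by vanishing binomial coefficients so that it splits into
  -- even and odd exponents.
  have h1 : ∀ k, w k * ‖a • z + b • (u k * η)‖ ^ (2 * s) =
      ∑ j ∈ Finset.range (2 * (s + 1)), (s.choose j * (2 * a * b) ^ j * (X + Y) ^ (s - j)) *
        (w k * inner ℝ (u k) (z * star η) ^ j) := by
    intro k
    rw [pow_mul, Quaternion.norm_smul_add_smul_mul_sq _ _ _ _ _ (hu k), add_comm, add_pow,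
      Finset.mul_sum]
    refine (Finset.sum_congr rfl fun j _ => ?_).trans
      (Finset.sum_subset (Finset.range_subset_range.2 (by omega)) fun j _ hj => ?_)
    · rw [mul_pow]
      ring
    · rw [Nat.choose_eq_zero_of_lt (by simpa using hj)]
      simp
  rw [Finset.sum_congr rfl fun k _ => h1 k, Finset.sum_comm, Finset.sum_range_two_mul,
    ← sum_centralBinom_mul_pow]
  refine Finset.sum_congr rfl fun l _ => ?_
  rw [← Finset.mul_sum, ← Finset.mul_sum]
  by_cases hl : 2 * l ≤ s
  · rw [heven l (by omega), hodd l (by omega), mul_zero, add_zero, norm_mul, Quaternion.norm_star,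
      pow_mul, pow_mul, show (2 * a * b) ^ 2 = 4 * (a ^ 2 * b ^ 2) by ring, mul_pow (4 : ℝ)]
    have : X * Y = a ^ 2 * b ^ 2 * (‖z‖ * ‖η‖) ^ 2 := by simp only [X, Y]; ring
    rw [this, mul_pow (a ^ 2 * b ^ 2)]
    have h4 : (4 : ℝ) ^ l ≠ 0 := by positivity
    field_simp
  · rw [Nat.choose_eq_zero_of_lt (by omega : s < 2 * l),
      Nat.choose_eq_zero_of_lt (by omega : s < 2 * l + 1)]
    simp

/-! ### Lowering the index with the Laplacian -/

open Polynomial in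
/-- Comparing the second derivatives at `0` of powers of quadratic polynomials. -/
lemma second_derivative_quadratic_pow {ι : Type*} [Fintype ι] {n : ℕ} (w A B C : ι → ℝ)
    (κ A₀ B₀ C₀ : ℝ)
    (h : ∀ t : ℝ, ∑ k, w k * (A k + 2 * B k * t + C k * t ^ 2) ^ (n + 1) =
      κ * (A₀ + 2 * B₀ * t + C₀ * t ^ 2) ^ (n + 1)) :
    ∑ k, w k * (2 * n * A k ^ (n - 1) * B k ^ 2 + A k ^ n * C k) =
      κ * (2 * n * A₀ ^ (n - 1) * B₀ ^ 2 + A₀ ^ n * C₀) := by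
  have hp : ∑ k, Polynomial.C (w k) * (Polynomial.C (A k) + Polynomial.C (2 * B k) * X +
        Polynomial.C (C k) * X ^ 2) ^ (n + 1) =
      Polynomial.C κ * (Polynomial.C A₀ + Polynomial.C (2 * B₀) * X +
        Polynomial.C C₀ * X ^ 2) ^ (n + 1) := by
    refine Polynomial.funext fun t => ?_
    simpa [eval_finsetSum] using h t
  have hd := congrArg (fun p => eval 0 (derivative (derivative p))) hp
  have hder : ∀ a b c v : ℝ, eval 0 (derivative (derivative (Polynomial.C v * (Polynomial.C a +
      Polynomial.C (2 * b) * X + Polynomial.C c * X ^ 2) ^ (n + 1)))) =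
      2 * (n + 1) * (v * (2 * n * a ^ (n - 1) * b ^ 2 + a ^ n * c)) := by
    intro a b c v
    simp [derivative_pow]
    ring
  simp only [derivative_sum, eval_finsetSum, hder, ← Finset.mul_sum] at hd
  exact mul_left_cancel₀ (by positivity) hd

/-- The standard real basis `1, i, j, k` of the quaternions. -/
def Quaternion.unit : Fin 4 → Quaternion ℝ :=
  ![⟨1, 0, 0, 0⟩, ⟨0, 1, 0, 0⟩, ⟨0, 0, 1, 0⟩, ⟨0, 0, 0, 1⟩]

lemma Quaternion.norm_sq_eq (v : Quaternion ℝ) :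
    ‖v‖ ^ 2 = v.re ^ 2 + v.imI ^ 2 + v.imJ ^ 2 + v.imK ^ 2 := by
  rw [sq, ← Quaternion.normSq_eq_norm_mul_self, Quaternion.normSq_def']

lemma Quaternion.norm_unit_sq (m : Fin 4) : ‖unit m‖ ^ 2 = 1 := by
  rw [Quaternion.norm_sq_eq]
  fin_cases m <;> simp [unit]

lemma Quaternion.sum_inner_unit_sq (v : Quaternion ℝ) :
    ∑ m, inner ℝ v (unit m) ^ 2 = ‖v‖ ^ 2 := by
  simp only [Quaternion.norm_sq_eq, Quaternion.inner_def, Quaternion.re_mul, Quaternion.re_star,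
    Quaternion.imI_star, Quaternion.imJ_star, Quaternion.imK_star, Fin.sum_univ_four]
  simp [unit]

/-- Left multiplication by `c` has adjoint left multiplication by `star c`, which reduces this to
Parseval for the standard basis. -/
lemma Quaternion.sum_inner_mul_unit_sq (z c : Quaternion ℝ) :
    ∑ m, inner ℝ z (c * unit m) ^ 2 = ‖z‖ ^ 2 * ‖c‖ ^ 2 := by
  have h : ∀ m, inner ℝ z (c * unit m) = inner ℝ (star c * z) (unit m) := fun m => by
    have h2 : ∀ x y : Quaternion ℝ, (x * y).re = (y * x).re := fun x y => by
      simp only [Quaternion.re_mul]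
      ring
    rw [Quaternion.inner_def, Quaternion.inner_def, star_mul, ← mul_assoc, h2, ← mul_assoc]
  simp only [h, Quaternion.sum_inner_unit_sq, norm_mul, Quaternion.norm_star]
  ring

/-- Lowering the index of a cubature identity by applying the Laplacian. -/
lemma sum_norm_pow_lower {K : Type*} [Fintype K] {M n : ℕ} (c : K → Fin M → Quaternion ℝ)
    (w : K → ℝ) (κ : ℝ)
    (h : ∀ x : Fin M → Quaternion ℝ, ∑ k, w k * ‖∑ i, c k i * x i‖ ^ (2 * (n + 1)) =
      κ * (∑ i, ‖x i‖ ^ 2) ^ (n + 1)) (x : Fin M → Quaternion ℝ) :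
    ∑ k, w k * (∑ i, ‖c k i‖ ^ 2) * ‖∑ i, c k i * x i‖ ^ (2 * n) =
      κ * ((n + 2 * M) / (n + 2)) * (∑ i, ‖x i‖ ^ 2) ^ n := by
  -- The truncated exponent `n - 1` at `n = 0` is harmless because of the factor `n`.
  have hpow : ∀ a : ℝ, n * a ^ (n - 1) * a = n * a ^ n := fun a => by
    cases n with
    | zero => simp
    | succ n => rw [Nat.add_sub_cancel, pow_succ]; ring
  have key : ∀ (j : Fin M) (m : Fin 4),
      ∑ k, w k * (2 * n * (‖∑ i, c k i * x i‖ ^ 2) ^ (n - 1) *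
        inner ℝ (∑ i, c k i * x i) (c k j * Quaternion.unit m) ^ 2 +
        (‖∑ i, c k i * x i‖ ^ 2) ^ n * ‖c k j‖ ^ 2) =
      κ * (2 * n * (∑ i, ‖x i‖ ^ 2) ^ (n - 1) * inner ℝ (x j) (Quaternion.unit m) ^ 2 +
        (∑ i, ‖x i‖ ^ 2) ^ n * 1) := by
    intro j m
    apply second_derivative_quadratic_pow
    intro t
    obtain ⟨y, hyj, hy⟩ : ∃ y : Fin M → Quaternion ℝ, y j = t • Quaternion.unit m ∧
        ∀ i ≠ j, y i = 0 :=
      ⟨Pi.single j (t • Quaternion.unit m), Pi.single_eq_same _ _,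
        fun i hi => Pi.single_eq_of_ne hi _⟩
    have hx := h (x + y)
    have h1 : ∀ k, ‖∑ i, c k i * (x + y) i‖ ^ 2 =
        ‖∑ i, c k i * x i‖ ^ 2 +
          2 * inner ℝ (∑ i, c k i * x i) (c k j * Quaternion.unit m) * t +
          ‖c k j‖ ^ 2 * t ^ 2 := by
      intro k
      have : ∑ i, c k i * (x + y) i =
          ∑ i, c k i * x i + t • (c k j * Quaternion.unit m) := by
        simp only [Pi.add_apply, mul_add, Finset.sum_add_distrib]
        congr 1
        rw [Finset.sum_eq_single_of_mem j (Finset.mem_univ j)]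
        · rw [hyj, mul_smul_comm]
        · intro i _ hi
          rw [hy i hi, mul_zero]
      rw [this, norm_add_sq_real, real_inner_smul_right, norm_smul, norm_mul, mul_pow, mul_pow,
        Quaternion.norm_unit_sq, Real.norm_eq_abs, sq_abs]
      ring
    have h2 : ∑ i, ‖(x + y) i‖ ^ 2 =
        ∑ i, ‖x i‖ ^ 2 + 2 * inner ℝ (x j) (Quaternion.unit m) * t + 1 * t ^ 2 := by
      have h3 : ∀ i, ‖(x + y) i‖ ^ 2 = ‖x i‖ ^ 2 +
          if i = j then 2 * inner ℝ (x j) (Quaternion.unit m) * t + 1 * t ^ 2 else 0 := by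
        intro i
        rw [Pi.add_apply]
        split_ifs with hi
        · rw [hi, hyj, norm_add_sq_real, real_inner_smul_right, norm_smul, mul_pow,
            Quaternion.norm_unit_sq, Real.norm_eq_abs, sq_abs]
          ring
        · rw [hy i hi, add_zero, add_zero]
      rw [Finset.sum_congr rfl fun i _ => h3 i, Finset.sum_add_distrib, Finset.sum_ite_eq',
        if_pos (Finset.mem_univ j), add_assoc]
    simp only [pow_mul, h1, h2] at hx
    exact hx
  -- Summing the second derivatives over all `4M` real directions gives the Laplacian. The right
  -- side acquires `2n + 4M`, and each term on the left `2n + 4`, since a single form sees only four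
  -- dimensions.
  have hsum := Finset.sum_congr rfl fun (j : Fin M) (_ : j ∈ Finset.univ) =>
    Finset.sum_congr rfl fun (m : Fin 4) (_ : m ∈ Finset.univ) => key j m
  have hR : ∑ j, ∑ m, κ * (2 * n * (∑ i, ‖x i‖ ^ 2) ^ (n - 1) *
      inner ℝ (x j) (Quaternion.unit m) ^ 2 + (∑ i, ‖x i‖ ^ 2) ^ n * 1) =
      κ * (2 * (n + 2 * M)) * (∑ i, ‖x i‖ ^ 2) ^ n := by
    simp only [← Finset.mul_sum, Finset.sum_add_distrib, Quaternion.sum_inner_unit_sq,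
      Finset.sum_const, Finset.card_univ, Fintype.card_fin, nsmul_eq_mul, mul_one]
    push_cast
    linear_combination (2 * κ) * hpow (∑ i, ‖x i‖ ^ 2)
  have hL : ∀ k, ∑ j, ∑ m, w k * (2 * n * (‖∑ i, c k i * x i‖ ^ 2) ^ (n - 1) *
        inner ℝ (∑ i, c k i * x i) (c k j * Quaternion.unit m) ^ 2 +
        (‖∑ i, c k i * x i‖ ^ 2) ^ n * ‖c k j‖ ^ 2) =
      2 * (n + 2) * (w k * (∑ i, ‖c k i‖ ^ 2) * ‖∑ i, c k i * x i‖ ^ (2 * n)) := by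
    intro k
    simp only [← Finset.mul_sum, Finset.sum_add_distrib, Quaternion.sum_inner_mul_unit_sq,
      Finset.sum_const, Finset.card_univ, Fintype.card_fin, nsmul_eq_mul]
    rw [pow_mul]
    push_cast
    linear_combination (2 * w k * ∑ i, ‖c k i‖ ^ 2) * hpow (‖∑ i, c k i * x i‖ ^ 2)
  rw [hR, Finset.sum_congr rfl fun j _ => Finset.sum_comm, Finset.sum_comm,
    Finset.sum_congr rfl fun k _ => hL k, ← Finset.mul_sum] at hsum
  have h2 : (n : ℝ) + 2 ≠ 0 := by positivity
  field_simp
  linear_combination hsum / 2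

/-- A cubature identity of index `2 * s` gives identities of all the lower even indices. -/
lemma sum_norm_pow_of_le {K : Type*} [Fintype K] {e M s : ℕ} (hM : 2 * M = e + 1)
    (c : K → Fin M → Quaternion ℝ)
    (h : ∀ x : Fin M → Quaternion ℝ, ∑ k, ‖∑ i, c k i * x i‖ ^ (2 * s) =
      (∑ i, ‖x i‖ ^ 2) ^ s) {i d : ℕ} (hid : i + d = s) (x : Fin M → Quaternion ℝ) :
    ∑ k, (∑ i, ‖c k i‖ ^ 2) ^ d * ‖∑ i, c k i * x i‖ ^ (2 * i) =
      ((s + e).factorial * (i + 1).factorial : ℝ) / ((i + e).factorial * (s + 1).factorial) *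
        (∑ i, ‖x i‖ ^ 2) ^ i := by
  induction d generalizing i x with
  | zero =>
    obtain rfl : i = s := by omega
    have h1 : ((i + e).factorial : ℝ) ≠ 0 := by positivity
    have h2 : ((i + 1).factorial : ℝ) ≠ 0 := by positivity
    simp only [pow_zero, one_mul, h]
    field_simp
  | succ d ih =>
    -- Each lowering contributes the factor `(i + e + 1) / (i + 2)`, and these telescope to the
    -- ratio of factorials.
    have h1 := sum_norm_pow_lower c _ _ (fun x => ih (i := i + 1) (by omega) x) x
    rw [Finset.sum_congr rfl fun k _ => by rw [pow_succ], h1]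
    congr 1
    rw [show i + 1 + e = i + e + 1 by ring, Nat.factorial_succ (i + e), Nat.factorial_succ (i + 1)]
    have hM' : (2 : ℝ) * M = e + 1 := by exact_mod_cast hM
    have h2 : ((i + e).factorial : ℝ) ≠ 0 := by positivity
    have h3 : ((s + 1).factorial : ℝ) ≠ 0 := by positivity
    rw [hM']
    push_cast
    field_simp
    ring

/-! ### Isometric embeddings as cubature identities -/

/-- A weighted cubature identity of index `2 * s` gives an isometric embedding. -/
lemma hasQuatIsometricEmbedding_card {ι : Type*} [Fintype ι] {m s : ℕ} (hs : s ≠ 0)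
    (c : ι → Fin m → Quaternion ℝ) (w : ι → ℝ) (hw : ∀ k, 0 ≤ w k) {C : ℝ} (hC : 0 < C)
    (h : ∀ x : Fin m → Quaternion ℝ, ∑ k, w k * ‖∑ i, c k i * x i‖ ^ (2 * s) =
      C * (∑ i, ‖x i‖ ^ 2) ^ s) :
    HasQuatIsometricEmbedding m (2 * s) (Fintype.card ι) := by
  let e := Fintype.equivFin ι
  let f : QuatLp 2 m →ₗ[(Quaternion ℝ)ᵐᵒᵖ] QuatLp ((2 * s : ℕ) : ENNReal) (Fintype.card ι) :=
    { toFun := fun y => WithLp.toLp _ fun k =>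
        (w (e.symm k) / C) ^ ((2 * s : ℕ) : ℝ)⁻¹ • ∑ i, c (e.symm k) i * y i
      map_add' := fun y z => by
        ext1 k
        simp [mul_add, Finset.sum_add_distrib]
      map_smul' := fun a y => by
        ext1 k
        simp [Finset.sum_mul, mul_assoc] }
  have h2s : 2 * s ≠ 0 := by omega
  refine ⟨f, fun y => ?_⟩
  have hp : 0 < ((2 * s : ℕ) : ENNReal).toReal := by
    rw [ENNReal.toReal_natCast]
    positivity
  have hterm : ∀ k, ‖f y k‖ ^ (2 * s) =
      w (e.symm k) / C * ‖∑ i, c (e.symm k) i * y i‖ ^ (2 * s) := fun k => by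
    have hk : 0 ≤ w (e.symm k) / C := div_nonneg (hw _) hC.le
    change ‖(w (e.symm k) / C) ^ ((2 * s : ℕ) : ℝ)⁻¹ • ∑ i, c (e.symm k) i * y i‖ ^ (2 * s) = _
    rw [norm_smul, mul_pow, Real.norm_of_nonneg (Real.rpow_nonneg hk _),
      Real.rpow_inv_natCast_pow hk h2s]
  have hsum : ∑ k, ‖f y k‖ ^ (2 * s) = ‖y‖ ^ (2 * s) := by
    rw [Finset.sum_congr rfl fun k _ => hterm k, e.symm.sum_comp (fun k =>
      w k / C * ‖∑ i, c k i * y i‖ ^ (2 * s)), pow_mul, PiLp.norm_sq_eq_of_L2]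
    have := h y
    simp only [div_mul_eq_mul_div, ← Finset.sum_div]
    rw [this]
    field_simp
  rw [PiLp.norm_eq_sum hp]
  simp only [ENNReal.toReal_natCast, Real.rpow_natCast]
  rw [hsum, one_div, Real.pow_rpow_inv_natCast (norm_nonneg _) h2s]

/-- The coefficients are the coordinates of the images of the standard basis; since scalars act on
the right, they multiply `x i` from the left. -/
lemma HasQuatIsometricEmbedding.exists_coeff {m s n : ℕ} (hs : s ≠ 0)
    (h : HasQuatIsometricEmbedding m (2 * s) n) :
    ∃ c : Fin n → Fin m → Quaternion ℝ, ∀ x : Fin m → Quaternion ℝ,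
      ∑ k, ‖∑ i, c k i * x i‖ ^ (2 * s) = (∑ i, ‖x i‖ ^ 2) ^ s := by
  obtain ⟨f, hf⟩ := h
  refine ⟨fun k i => f (WithLp.toLp 2 (Pi.single i 1)) k, fun x => ?_⟩
  have hx : WithLp.toLp 2 x = ∑ i, MulOpposite.op (x i) •
      (WithLp.toLp 2 (Pi.single i 1) : QuatLp 2 m) := by
    ext1 j
    rw [WithLp.ofLp_sum, Finset.sum_apply, Finset.sum_eq_single_of_mem j (Finset.mem_univ j)]
    · simp
    · intro i _ hij
      simp [hij.symm]
  have hfx : ∀ k, f (WithLp.toLp 2 x) k =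
      ∑ i, f (WithLp.toLp 2 (Pi.single i 1)) k * x i := fun k => by
    rw [hx, map_sum, WithLp.ofLp_sum, Finset.sum_apply]
    refine Finset.sum_congr rfl fun i _ => ?_
    rw [map_smul]
    simp
  have hp : 0 < ((2 * s : ℕ) : ENNReal).toReal := by
    rw [ENNReal.toReal_natCast]
    positivity
  have h1 := hf (WithLp.toLp 2 x)
  rw [PiLp.norm_eq_sum hp] at h1
  simp only [ENNReal.toReal_natCast, Real.rpow_natCast, hfx] at h1
  have h2 := PiLp.norm_sq_eq_of_L2 _ (WithLp.toLp 2 x : QuatLp 2 m)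
  rw [← h2, ← pow_mul, ← h1, one_div, Real.rpow_inv_natCast_pow (by positivity) (by omega)]

lemma hasQuatIsometricEmbedding_one {s : ℕ} (hs : s ≠ 0) :
    HasQuatIsometricEmbedding 1 (2 * s) 1 := by
  have := hasQuatIsometricEmbedding_card (ι := Fin 1) (m := 1) hs (fun _ _ => 1) (fun _ => 1)
    (fun _ => zero_le_one) one_pos (fun x => by simp [pow_mul])
  simpa using this

/-! ### The product construction and the recursion -/

/-- The moments of the Jacobi weight match the constants coming from the averages over the
quaternionic sphere and from lowering the index. -/
lemma narayana_mul_moment {s i e : ℕ} (hi : i ≤ s) :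
    (s.choose i * (s + 1).choose i / (i + 1) : ℝ) *
      (((s + e).factorial * (i + 1).factorial : ℝ) / ((i + e).factorial * (s + 1).factorial)) *
      (((i + e).factorial * (s - i + 1).factorial : ℝ) / (s + e + 2).factorial) =
    ((s + e).factorial : ℝ) / (s + e + 2).factorial * s.choose i := by
  have h := Nat.choose_mul_factorial_mul_factorial (show i ≤ s + 1 by omega)
  rw [show s + 1 - i = s - i + 1 by omega] at h
  have h' : ((s + 1).choose i * i.factorial * (s - i + 1).factorial : ℝ) = (s + 1).factorial := by
    exact_mod_cast h
  have h1 : ((s + e + 2).factorial : ℝ) ≠ 0 := by positivity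
  have h2 : ((i + e).factorial : ℝ) ≠ 0 := by positivity
  have h3 : ((s + 1).factorial : ℝ) ≠ 0 := by positivity
  rw [Nat.factorial_succ i]
  push_cast
  field_simp
  linear_combination (s.choose i : ℝ) * h'

open Polynomial in
/-- The product cubature identity for `‖y‖ ^ 2 + ‖η‖ ^ 2`, built from a cubature identity for
`‖y‖ ^ 2`, a quadrature for the Jacobi weight `t ^ e * (1 - t)` with the possible extra node `0`,
and a design of unit quaternions. -/
lemma sum_norm_pow_product {K J ι : Type*} [Fintype K] [Fintype J] [Fintype ι] {e M r s : ℕ}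
    (hM : 2 * M = e + 1) (hs : s < 2 * r)
    (c : K → Fin M → Quaternion ℝ)
    (hc : ∀ x : Fin M → Quaternion ℝ, ∑ k, ‖∑ i, c k i * x i‖ ^ (2 * s) =
      (∑ i, ‖x i‖ ^ 2) ^ s)
    (t v : J → ℝ) (v₀ : ℝ) (ht0 : ∀ j, 0 ≤ t j) (ht1 : ∀ j, t j ≤ 1)
    (hq : ∀ p : ℝ[X], p.natDegree ≤ s → v₀ * p.eval 0 + ∑ j, v j * p.eval (t j) =
      unitIntervalIntegral (X ^ e * (1 - X) * p))
    (u : ι → Quaternion ℝ) (w : ι → ℝ) (hu : ∀ i, ‖u i‖ = 1)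
    (heven : ∀ l < r, ∀ v, ∑ i, w i * inner ℝ (u i) v ^ (2 * l) =
        l.centralBinom / (l + 1) / 4 ^ l * ‖v‖ ^ (2 * l))
    (hodd : ∀ l < r, ∀ v, ∑ i, w i * inner ℝ (u i) v ^ (2 * l + 1) = 0)
    (y : Fin M → Quaternion ℝ) (η : Quaternion ℝ) :
    ∑ k, ∑ j, ∑ q, v j * w q * ‖√(t j) • ∑ i, c k i * y i +
        (√(1 - t j) * √(∑ i, ‖c k i‖ ^ 2)) • (u q * η)‖ ^ (2 * s) +
      ((s + e).factorial : ℝ) / (e.factorial * (s + 1).factorial) * v₀ * ‖η‖ ^ (2 * s) =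
    ((s + e).factorial : ℝ) / (s + e + 2).factorial * (∑ i, ‖y i‖ ^ 2 + ‖η‖ ^ 2) ^ s := by
  -- The extra node `0` affects only the moment `i = 0`, hence the correction `v₀ * 0 ^ i`.
  have hmom : ∀ i ≤ s, ∑ j, v j * (t j ^ i * (1 - t j) ^ (s - i)) =
      ((i + e).factorial * (s - i + 1).factorial : ℝ) / (s + e + 2).factorial -
        v₀ * 0 ^ i := by
    intro i hi
    have h := hq (X ^ i * (1 - X) ^ (s - i))
      ((natDegree_X_pow_mul_one_sub_X_pow_le _ _).trans (by omega))
    rw [show (X ^ e * (1 - X) * (X ^ i * (1 - X) ^ (s - i)) : ℝ[X]) =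
      X ^ (i + e) * (1 - X) ^ (s - i + 1) by ring, unitIntervalIntegral_X_pow_mul,
      show i + e + (s - i + 1) + 1 = s + e + 2 by omega] at h
    simp at h
    linear_combination h
  have hterm : ∀ k, ∑ j, ∑ q, v j * w q * ‖√(t j) • ∑ i, c k i * y i +
        (√(1 - t j) * √(∑ i, ‖c k i‖ ^ 2)) • (u q * η)‖ ^ (2 * s) =
      ∑ i ∈ Finset.range (s + 1), (s.choose i * (s + 1).choose i / (i + 1) : ℝ) *
        (((i + e).factorial * (s - i + 1).factorial : ℝ) / (s + e + 2).factorial -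
          v₀ * 0 ^ i) * (‖η‖ ^ 2) ^ (s - i) *
        ((∑ i, ‖c k i‖ ^ 2) ^ (s - i) * ‖∑ i, c k i * y i‖ ^ (2 * i)) := by
    intro k
    have h1 : ∀ j, ∑ q, v j * w q * ‖√(t j) • ∑ i, c k i * y i +
        (√(1 - t j) * √(∑ i, ‖c k i‖ ^ 2)) • (u q * η)‖ ^ (2 * s) =
        ∑ i ∈ Finset.range (s + 1), (s.choose i * (s + 1).choose i / (i + 1) : ℝ) *
          (‖η‖ ^ 2) ^ (s - i) *
          ((∑ i, ‖c k i‖ ^ 2) ^ (s - i) * ‖∑ i, c k i * y i‖ ^ (2 * i)) *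
          (v j * (t j ^ i * (1 - t j) ^ (s - i))) := by
      intro j
      simp only [mul_assoc (v j), ← Finset.mul_sum]
      rw [sum_norm_smul_add_smul_mul_pow hs u w hu heven hodd, Finset.mul_sum]
      refine Finset.sum_congr rfl fun i _ => ?_
      rw [mul_pow √(1 - t j), Real.sq_sqrt (ht0 j), Real.sq_sqrt (sub_nonneg.2 (ht1 j)),
        Real.sq_sqrt (Finset.sum_nonneg fun _ _ => sq_nonneg _), pow_mul, mul_pow, mul_pow,
        mul_pow]
      ring
    rw [Finset.sum_congr rfl fun j _ => h1 j, Finset.sum_comm]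
    refine Finset.sum_congr rfl fun i hi => ?_
    rw [← Finset.mul_sum, hmom i (Finset.mem_range_succ_iff.1 hi)]
    ring
  rw [Finset.sum_congr rfl fun k _ => hterm k, Finset.sum_comm]
  -- The scaling by `|c_k|` supplies the factor `|c_k|^(2(s - i))` required by the lowered identity.
  -- Lowering down to `i = 0` evaluates `∑ |c_k|^(2s)`, which is the coefficient of `v₀ |η|^(2s)`.
  have hterm2 : ∀ i ∈ Finset.range (s + 1), ∑ k, (s.choose i * (s + 1).choose i / (i + 1) : ℝ) *
        (((i + e).factorial * (s - i + 1).factorial : ℝ) / (s + e + 2).factorial -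
          v₀ * 0 ^ i) * (‖η‖ ^ 2) ^ (s - i) *
        ((∑ i, ‖c k i‖ ^ 2) ^ (s - i) * ‖∑ i, c k i * y i‖ ^ (2 * i)) =
      ((s + e).factorial : ℝ) / (s + e + 2).factorial * ((∑ i, ‖y i‖ ^ 2) ^ i *
        (‖η‖ ^ 2) ^ (s - i) * s.choose i) -
      if i = 0 then ((s + e).factorial : ℝ) / (e.factorial * (s + 1).factorial) * v₀ *
        ‖η‖ ^ (2 * s) else 0 := by
    intro i hi
    have hi' := Finset.mem_range_succ_iff.1 hi
    have h2 := narayana_mul_moment (e := e) hi'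
    rw [← Finset.mul_sum, sum_norm_pow_of_le hM c hc (show i + (s - i) = s by omega)]
    split_ifs with h0
    · subst h0
      simp at h2 ⊢
      rw [pow_mul]
      linear_combination ((‖η‖ ^ 2) ^ s) * h2
    · rw [zero_pow h0]
      linear_combination ((‖η‖ ^ 2) ^ (s - i) * (∑ i, ‖y i‖ ^ 2) ^ i) * h2
  rw [Finset.sum_congr rfl hterm2, Finset.sum_sub_distrib, ← Finset.mul_sum, ← add_pow,
    Finset.sum_ite_eq', if_pos (by simp)]
  ring

open Polynomial in
lemma isPositiveOnUnitInterval_jacobi (e : ℕ) :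
    IsPositiveOnUnitInterval
      (unitIntervalIntegral ∘ₗ LinearMap.mulLeft ℝ (X ^ e * (1 - X) : ℝ[X])) := by
  refine isPositiveOnUnitInterval_unitIntervalIntegral.comp_mul
    (mul_ne_zero (pow_ne_zero _ X_ne_zero) fun h => ?_) fun t ht => ?_
  · have := congrArg (eval 0) h
    simp at this
  · simp only [eval_mul, eval_pow, eval_X, eval_sub, eval_one]
    exact mul_nonneg (pow_nonneg ht.1 _) (sub_nonneg.2 ht.2)

/-- The recursion with the Gauss quadrature. -/
theorem HasQuatIsometricEmbedding.succ_of_gauss {M s n r G N : ℕ} (hM : 1 ≤ M) (hs : s ≠ 0)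
    (hr : s < 2 * r) (hG : r ≤ 2 * G) (hN : s < 2 * N)
    (h : HasQuatIsometricEmbedding M (2 * s) n) :
    HasQuatIsometricEmbedding (M + 1) (2 * s) (n * (N * (2 * r * (r * G)))) := by
  obtain ⟨c, hc⟩ := h.exists_coeff hs
  -- `e = 2M - 1` is the exponent of `t` in the density of `|y|²` on the unit sphere of `ℍ^(M+1)`.
  obtain ⟨e, he⟩ : ∃ e, 2 * M = e + 1 := ⟨2 * M - 1, by omega⟩
  obtain ⟨u, w, hu, hw, heven, hodd⟩ := exists_quaternion_design (show 0 < r by omega) hG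
  obtain ⟨t, v, ht0, ht1, hv, hq⟩ := (isPositiveOnUnitInterval_jacobi e).exists_gauss N
  have key := sum_norm_pow_product he hr c hc t v 0 (fun j => (ht0 j).le) ht1
    (fun p hp => by rw [zero_mul, zero_add]; exact hq p (by omega)) u w hu heven hodd
  have := hasQuatIsometricEmbedding_card (ι := Fin n × Fin N × Fin (2 * r) × Fin r × Fin G)
    (m := M + 1) (s := s) hs
    (fun k => Fin.cons ((√(1 - t k.2.1) * √(∑ i, ‖c k.1 i‖ ^ 2)) • u k.2.2)
      fun i => √(t k.2.1) • c k.1 i)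
    (fun k => v k.2.1 * w k.2.2) (fun k => mul_nonneg (hv _) (hw _))
    (C := ((s + e).factorial : ℝ) / (s + e + 2).factorial) (by positivity) fun x => by
      have h1 := key (fun i => x i.succ) (x 0)
      rw [mul_zero, zero_mul, add_zero] at h1
      rw [Fin.sum_univ_succ, add_comm (‖x 0‖ ^ 2), ← h1, Fintype.sum_prod_type]
      refine Finset.sum_congr rfl fun k _ => ?_
      rw [Fintype.sum_prod_type]
      refine Finset.sum_congr rfl fun j _ => Finset.sum_congr rfl fun q _ => ?_
      simp only [Fin.sum_univ_succ, Fin.cons_zero, Fin.cons_succ, smul_mul_assoc,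
        ← Finset.smul_sum]
      rw [add_comm]
  simpa using this

/-- The recursion with the Gauss–Radau quadrature. -/
theorem HasQuatIsometricEmbedding.succ_of_radau {M s n r G N : ℕ} (hM : 1 ≤ M) (hs : s ≠ 0)
    (hr : s < 2 * r) (hG : r ≤ 2 * G) (hN : s ≤ 2 * N)
    (h : HasQuatIsometricEmbedding M (2 * s) n) :
    HasQuatIsometricEmbedding (M + 1) (2 * s) (n * (N * (2 * r * (r * G))) + 1) := by
  obtain ⟨c, hc⟩ := h.exists_coeff hs
  obtain ⟨e, he⟩ : ∃ e, 2 * M = e + 1 := ⟨2 * M - 1, by omega⟩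
  obtain ⟨u, w, hu, hw, heven, hodd⟩ := exists_quaternion_design (show 0 < r by omega) hG
  obtain ⟨t, v, v₀, ht0, ht1, hv, hv₀, hq⟩ := (isPositiveOnUnitInterval_jacobi e).exists_radau N
  have key := sum_norm_pow_product he hr c hc t v v₀ (fun j => (ht0 j).le) ht1
    (fun p hp => hq p (by omega)) u w hu heven hodd
  have := hasQuatIsometricEmbedding_card
    (ι := Option (Fin n × Fin N × Fin (2 * r) × Fin r × Fin G)) (m := M + 1) (s := s) hs
    -- The `none` index is the merged node `t = 0`: the single form `x ↦ x 0`.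
    (fun o => o.elim (Fin.cons 1 fun _ => 0) fun k =>
      Fin.cons ((√(1 - t k.2.1) * √(∑ i, ‖c k.1 i‖ ^ 2)) • u k.2.2) fun i => √(t k.2.1) • c k.1 i)
    (fun o => o.elim (((s + e).factorial : ℝ) / (e.factorial * (s + 1).factorial) * v₀)
      fun k => v k.2.1 * w k.2.2)
    (fun o => by
      cases o with
      | none => exact mul_nonneg (by positivity) hv₀
      | some k => exact mul_nonneg (hv _) (hw _))
    (C := ((s + e).factorial : ℝ) / (s + e + 2).factorial) (by positivity) fun x => by
      have h1 := key (fun i => x i.succ) (x 0)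
      rw [Fin.sum_univ_succ, add_comm (‖x 0‖ ^ 2), ← h1, Fintype.sum_option, add_comm]
      congr 1
      · rw [Fintype.sum_prod_type]
        refine Finset.sum_congr rfl fun k _ => ?_
        rw [Fintype.sum_prod_type]
        refine Finset.sum_congr rfl fun j _ => Finset.sum_congr rfl fun q _ => ?_
        simp only [Option.elim, Fin.sum_univ_succ, Fin.cons_zero, Fin.cons_succ, smul_mul_assoc,
          ← Finset.smul_sum]
        rw [add_comm]
      · simp [Fin.sum_univ_succ]
  simpa using this

/-! ### Numerical bounds -/

lemma quatN_le {m p n : ℕ} (h : HasQuatIsometricEmbedding m p n) : quatN m p ≤ n :=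
  Nat.sInf_le h

theorem exists_hasQuatIsometricEmbedding {m s : ℕ} (hm : 1 ≤ m) (hs : s ≠ 0) :
    ∃ n, HasQuatIsometricEmbedding m (2 * s) n := by
  induction m, hm using Nat.le_induction with
  | base => exact ⟨1, hasQuatIsometricEmbedding_one hs⟩
  | succ m hm ih =>
    obtain ⟨n, hn⟩ := ih
    exact ⟨_, hn.succ_of_gauss (r := s + 1) (G := s + 1) (N := s + 1) hm hs (by omega) (by omega)
      (by omega)⟩

lemma hasQuatIsometricEmbedding_quatN {m s : ℕ} (hm : 1 ≤ m) (hs : s ≠ 0) :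
    HasQuatIsometricEmbedding m (2 * s) (quatN m (2 * s)) :=
  Nat.sInf_mem (exists_hasQuatIsometricEmbedding hm hs)

lemma quatN_succ_le_of_gauss {M s : ℕ} (r G N : ℕ) (hM : 1 ≤ M) (hs : s ≠ 0) (hr : s < 2 * r)
    (hG : r ≤ 2 * G) (hN : s < 2 * N) :
    quatN (M + 1) (2 * s) ≤ quatN M (2 * s) * (N * (2 * r * (r * G))) :=
  quatN_le ((hasQuatIsometricEmbedding_quatN hM hs).succ_of_gauss hM hs hr hG hN)

lemma quatN_succ_le_of_radau {M s : ℕ} (r G N : ℕ) (hM : 1 ≤ M) (hs : s ≠ 0) (hr : s < 2 * r)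
    (hG : r ≤ 2 * G) (hN : s ≤ 2 * N) :
    quatN (M + 1) (2 * s) ≤ quatN M (2 * s) * (N * (2 * r * (r * G))) + 1 :=
  quatN_le ((hasQuatIsometricEmbedding_quatN hM hs).succ_of_radau hM hs hr hG hN)

/-- The recursive bounds, according to the residue of `s` modulo `4`. -/
theorem sixteen_mul_quatN_succ_le {M s : ℕ} (hM : 1 ≤ M) (hs : 2 ≤ s) :
    (s % 4 = 3 → 16 * quatN (M + 1) (2 * s) ≤ (s + 1) ^ 4 * quatN M (2 * s)) ∧
    (s % 4 = 1 → 16 * quatN (M + 1) (2 * s) ≤ (s + 3) * (s + 1) ^ 3 * quatN M (2 * s)) ∧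
    (s % 4 = 2 → 16 * quatN (M + 1) (2 * s) ≤ (s + 2) ^ 3 * (s * quatN M (2 * s) + 1)) ∧
    (s % 4 = 0 →
      16 * quatN (M + 1) (2 * s) ≤ (s + 4) * (s + 2) ^ 2 * (s * quatN M (2 * s) + 1)) := by
  -- In each class `r`, `G`, `N` are the least integers allowed by `s < 2r`, `r ≤ 2G` and the
  -- quadrature condition: Gauss for odd `s`, Radau for even `s`. In the Radau cases the single
  -- extra node costs `16` after scaling, which the last summand of the claimed bound absorbs.
  refine ⟨fun h => ?_, fun h => ?_, fun h => ?_, fun h => ?_⟩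
  · obtain ⟨k, rfl⟩ : ∃ k, s = 4 * k + 3 := ⟨s / 4, by omega⟩
    refine (Nat.mul_le_mul_left 16 (quatN_succ_le_of_gauss (2 * k + 2) (k + 1) (2 * k + 2) hM
      (by omega) (by omega) (by omega) (by omega))).trans (le_of_eq ?_)
    ring
  · obtain ⟨k, rfl⟩ : ∃ k, s = 4 * k + 1 := ⟨s / 4, by omega⟩
    refine (Nat.mul_le_mul_left 16 (quatN_succ_le_of_gauss (2 * k + 1) (k + 1) (2 * k + 1) hM
      (by omega) (by omega) (by omega) (by omega))).trans (le_of_eq ?_)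
    ring
  · obtain ⟨k, rfl⟩ : ∃ k, s = 4 * k + 2 := ⟨s / 4, by omega⟩
    refine (Nat.mul_le_mul_left 16 (quatN_succ_le_of_radau (2 * k + 2) (k + 1) (2 * k + 1) hM
      (by omega) (by omega) (by omega) (by omega))).trans ?_
    generalize quatN M _ = n
    have h1 : 16 ≤ (4 * k + 2 + 2) ^ 3 :=
      le_trans (by norm_num) (Nat.pow_le_pow_left (show 4 ≤ 4 * k + 2 + 2 by omega) 3)
    calc _ = (4 * k + 2 + 2) ^ 3 * ((4 * k + 2) * n) + 16 := by ring
      _ ≤ _ := by rw [mul_add, mul_one]; exact Nat.add_le_add_left h1 _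
  · obtain ⟨k, rfl⟩ : ∃ k, s = 4 * k := ⟨s / 4, by omega⟩
    refine (Nat.mul_le_mul_left 16 (quatN_succ_le_of_radau (2 * k + 1) (k + 1) (2 * k) hM
      (by omega) (by omega) (by omega) (by omega))).trans ?_
    generalize quatN M _ = n
    have h1 : 16 ≤ (4 * k + 4) * (4 * k + 2) ^ 2 :=
      Nat.mul_le_mul (show 4 ≤ 4 * k + 4 by omega)
        (Nat.pow_le_pow_left (show 2 ≤ 4 * k + 2 by omega) 2)
    calc _ = (4 * k + 4) * (4 * k + 2) ^ 2 * (4 * k * n) + 16 := by ring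
      _ ≤ _ := by rw [mul_add, mul_one]; exact Nat.add_le_add_left h1 _

/-- The bounds for `m = 2`, according to the residue of `s` modulo `4`. -/
theorem sixteen_mul_quatN_two_le {s : ℕ} (hs : 2 ≤ s) :
    (s % 4 = 3 → 16 * quatN 2 (2 * s) ≤ (s + 1) ^ 4) ∧
    (s % 4 = 1 → 16 * quatN 2 (2 * s) ≤ (s + 3) * (s + 1) ^ 3) ∧
    (s % 4 = 2 → 16 * quatN 2 (2 * s) ≤ (s + 2) ^ 3 * (s + 1)) ∧
    (s % 4 = 0 → 16 * quatN 2 (2 * s) ≤ (s + 4) * (s + 2) ^ 2 * (s + 1)) := by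
  obtain ⟨h3, h1, h2, h0⟩ := sixteen_mul_quatN_succ_le le_rfl hs
  have hone : quatN 1 (2 * s) ≤ 1 := quatN_le (hasQuatIsometricEmbedding_one (by omega))
  have hs1 : s * quatN 1 (2 * s) ≤ s := by simpa using Nat.mul_le_mul_left s hone
  refine ⟨fun h => (h3 h).trans ?_, fun h => (h1 h).trans ?_, fun h => (h2 h).trans ?_,
    fun h => (h0 h).trans ?_⟩
  · exact (Nat.mul_le_mul_left _ hone).trans (mul_one _).le
  · exact (Nat.mul_le_mul_left _ hone).trans (mul_one _).le
  · exact Nat.mul_le_mul_left _ (by omega)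
  · exact Nat.mul_le_mul_left _ (by omega)

/-- A bound uniform in the residue class, with the same leading term `s ^ 4`, is all that the
asymptotic statement needs. -/
lemma sixteen_mul_quatN_two_le_pow {s : ℕ} (hs : 2 ≤ s) : 16 * quatN 2 (2 * s) ≤ (s + 4) ^ 4 := by
  obtain ⟨h3, h1, h2, h0⟩ := sixteen_mul_quatN_two_le hs
  have hs4 : s % 4 < 4 := Nat.mod_lt _ (by norm_num)
  interval_cases h : s % 4
  · refine (h0 rfl).trans ?_
    calc _ ≤ (s + 4) * (s + 4) ^ 2 * (s + 4) := by gcongr <;> omega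
      _ = _ := by ring
  · refine (h1 rfl).trans ?_
    calc _ ≤ (s + 4) * (s + 4) ^ 3 := by gcongr; all_goals omega
      _ = _ := by ring
  · refine (h2 rfl).trans ?_
    calc _ ≤ (s + 4) ^ 3 * (s + 4) := by gcongr; all_goals omega
      _ = _ := by ring
  · exact (h3 rfl).trans (Nat.pow_le_pow_left (by omega) 4)

open Filter Topology in
lemma eventually_quatN_two_le {ε : ℝ} (hε : 0 < ε) :
    ∀ᶠ s : ℕ in atTop, (quatN 2 (2 * s) : ℝ) ≤ (1 + ε) * ((s : ℝ) ^ 4 / 16) := by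
  have hlim : Tendsto (fun s : ℕ => (1 + 4 / (s : ℝ)) ^ 4) atTop (𝓝 1) := by
    have := ((tendsto_const_div_atTop_nhds_zero_nat (4 : ℝ)).const_add 1).pow 4
    simpa using this
  filter_upwards [hlim.eventually_le_const (show (1 : ℝ) < 1 + ε by linarith),
    eventually_ge_atTop 2] with s hs h2
  have h1 : (16 * quatN 2 (2 * s) : ℝ) ≤ (s + 4) ^ 4 := by
    exact_mod_cast sixteen_mul_quatN_two_le_pow h2
  have hs0 : (0 : ℝ) < s := by positivity
  have h3 : ((s : ℝ) + 4) ^ 4 = (1 + 4 / (s : ℝ)) ^ 4 * s ^ 4 := by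
    field_simp
  have h4 : (1 + 4 / (s : ℝ)) ^ 4 * s ^ 4 ≤ (1 + ε) * s ^ 4 := by gcongr
  linarith

theorem corollary4p13 :
    -- the minimal numbers are well defined
    (∀ m s : ℕ, 1 ≤ m → 2 ≤ s → ∃ n : ℕ, HasQuatIsometricEmbedding m (2 * s) n) ∧
    -- the recursive bounds
    (∀ m s : ℕ, 2 ≤ m → 2 ≤ s →
      (s % 4 = 3 →
        16 * quatN m (2 * s) ≤ (s + 1) ^ 4 * quatN (m - 1) (2 * s)) ∧
      (s % 4 = 1 →
        16 * quatN m (2 * s) ≤ (s + 3) * (s + 1) ^ 3 * quatN (m - 1) (2 * s)) ∧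
      (s % 4 = 2 →
        16 * quatN m (2 * s) ≤ (s + 2) ^ 3 * (s * quatN (m - 1) (2 * s) + 1)) ∧
      (s % 4 = 0 →
        16 * quatN m (2 * s) ≤ (s + 4) * (s + 2) ^ 2 * (s * quatN (m - 1) (2 * s) + 1))) ∧
    -- the particular case m = 2
    (∀ s : ℕ, 2 ≤ s →
      (s % 4 = 3 → 16 * quatN 2 (2 * s) ≤ (s + 1) ^ 4) ∧
      (s % 4 = 1 → 16 * quatN 2 (2 * s) ≤ (s + 3) * (s + 1) ^ 3) ∧
      (s % 4 = 2 → 16 * quatN 2 (2 * s) ≤ (s + 2) ^ 3 * (s + 1)) ∧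
      (s % 4 = 0 → 16 * quatN 2 (2 * s) ≤ (s + 4) * (s + 2) ^ 2 * (s + 1))) ∧
    -- the asymptotic bound for m = 2
    (∀ ε : ℝ, 0 < ε → ∀ᶠ s : ℕ in Filter.atTop,
      (quatN 2 (2 * s) : ℝ) ≤ (1 + ε) * ((s : ℝ) ^ 4 / 16)) := by
  refine ⟨fun m s hm hs => exists_hasQuatIsometricEmbedding hm (by omega), fun m s hm hs => ?_,
    fun s hs => sixteen_mul_quatN_two_le hs, fun ε hε => eventually_quatN_two_le hε⟩
  obtain ⟨M, rfl⟩ : ∃ M, m = M + 1 := ⟨m - 1, by omega⟩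
  exact sixteen_mul_quatN_succ_le (by omega) hs
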